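/- Let $\Sigma$ be a finite alphabet. A mean-payoff automaton expression $E$ over $\Sigma$ is built by the grammar $E ::= A \mid \max(E,E) \mid \min(E,E) \mid \mathrm{sum}(E,E)$, where $A$ ranges over the deterministic (complete, finite-state) $\mathbb{Q}$-weighted automata over $\Sigma$, each read either as a $\mathsf{LimInfAvg}$- or as a $\mathsf{LimSupAvg}$-automaton. The value $L_A(w)$ of a word $w\in\Sigma^\omega$ is $\liminf_{n\to\infty}\frac1n\sum_{i=0}^{n-1}v_i$, respectively $\limsup_{n\to\infty}\frac1n\sum_{i=0}^{n-1}v_i$, where $v_0v_1\dots$ are the weights along the unique run of $A$ over $w$; the operators $\max$, $\min$ and $\mathrm{sum}$ act pointwise on values, and this defines the quantitative language $L=L_E:\Sigma^\omega\to\mathbb{R}$. Let $A_E$ be the synchronized product of all automata occurring in $E$. For a strongly connected component (scc) $C$ of $A_E$, let $V_C$ be the set of the values $L(w)$ of all words $w\in\Sigma^\omega$ such that the run of $A_E$ over $w$ eventually stays in $C$. Theorem. Let $\eta\in\mathbb{R}$ be an isolated cut-point of $L$, that is, there exists $\epsilon>0$ such that $|L(w)-\eta|>\epsilon$ for all $w\in\Sigma^\omega$.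 Then: 1. The cut-point language $L^{\ge\eta}=\{w\in\Sigma^\omega \mid L(w)\ge\eta\}$ is $\omega$-regular, i.e. it is the language of a finite-state Büchi automaton. 2. For every scc $C$ of $A_E$ that is reachable from the initial state and contains a cycle, $V_C$ is a nonempty closed interval $[m_C,M_C]$, and $\eta\notin[m_C,M_C]$. 3. The automaton $A_E$ (without its weights), viewed as a Büchi automaton whose accepting states are the states that belong to an scc $C$ for which $V_C$ has a least element $m_C$ and $m_C>\eta$, accepts exactly $L^{\ge\eta}$. -/

import Mathlib

open Filter

universe u v w

/-- A deterministic weighted automaton over the alphabet `α` with weights in `W`: finitely many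
states, an initial state, and from every state exactly one transition for every letter. Since the
target of a transition is determined by its source and its letter, so is its weight. -/
structure DetWeightedAutomaton (α : Type u) (W : Type w) where
  State : Type v
  [finiteState : Finite State]
  init : State
  step : State → α → State
  wt : State → α → W

attribute [instance] DetWeightedAutomaton.finiteState

namespace DetWeightedAutomaton

variable {α : Type u} {W : Type w}

/-- The unique run of the automaton over an infinite word. -/
def run (A : DetWeightedAutomaton.{u, v, w} α W) (x : ℕ → α) : ℕ → A.State
  | 0 => A.init
  | n + 1 => A.step (run A x n) (x n)

/-- The sequence of weights that occur in the run over an infinite word. -/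
def runWeights (A : DetWeightedAutomaton.{u, v, w} α W) (x : ℕ → α) (n : ℕ) : W :=
  A.wt (A.run x n) (x n)

/-- There is a transition from `p` to `q`, for some letter. -/
def Edge (A : DetWeightedAutomaton.{u, v, w} α W) (p q : A.State) : Prop :=
  ∃ a : α, A.step p a = q

/-- The strongly connected component of the state `q` in the underlying graph. -/
def scc (A : DetWeightedAutomaton.{u, v, w} α W) (q : A.State) : Set A.State :=
  {p | Relation.ReflTransGen A.Edge q p ∧ Relation.ReflTransGen A.Edge p q}

/-- The automaton, without its weights, with accepting states `F`. -/
def withAccepting (A : DetWeightedAutomaton.{u, v, w} α W) (F : Set A.State) : NFA α A.State where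
  step q a := {A.step q a}
  start := {A.init}
  accept := F

end DetWeightedAutomaton

/-- The set of infinite words accepted by a nondeterministic automaton under the Büchi condition:
some run over the word visits accepting states infinitely often. -/
def NFA.buchiLanguage {α : Type u} {σ : Type v} (M : NFA α σ) : Set (ℕ → α) :=
  {x | ∃ r : ℕ → σ, r 0 ∈ M.start ∧ (∀ n, r (n + 1) ∈ M.step (r n) (x n)) ∧
    ∃ᶠ n in atTop, r n ∈ M.accept}

/-- A language of infinite words is `ω`-regular if a finite-state Büchi automaton accepts it. -/
def IsOmegaRegular {α : Type u} (S : Set (ℕ → α)) : Prop :=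
  ∃ (σ : Type) (_ : Finite σ) (M : NFA α σ), M.buchiLanguage = S

/-- The averages of the finite prefixes of a sequence. -/
noncomputable def prefixAvg (s : ℕ → ℝ) (n : ℕ) : ℝ :=
  (1 / (n : ℝ)) * ∑ i ∈ Finset.range n, s i

/-- The two mean-payoff value functions: `LimInfAvg` and `LimSupAvg`. -/
inductive LimAvgMode
  | limInf
  | limSup

/-- The mean-payoff value of a (bounded) sequence of real numbers. -/
noncomputable def LimAvgMode.val : LimAvgMode → (ℕ → ℝ) → ℝ
  | limInf, s => liminf (prefixAvg s) atTop
  | limSup, s => limsup (prefixAvg s) atTop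

/-- Mean-payoff automaton expressions over the alphabet `α`: the atoms are deterministic
`ℚ`-weighted automata, each read as a `LimInfAvg`- or as a `LimSupAvg`-automaton. -/
inductive MeanPayoffExpr (α : Type u) : Type (max u (v + 1))
  | atom (mode : LimAvgMode) (A : DetWeightedAutomaton.{u, v, 0} α ℚ) : MeanPayoffExpr α
  | emax (E F : MeanPayoffExpr α) : MeanPayoffExpr α
  | emin (E F : MeanPayoffExpr α) : MeanPayoffExpr α
  | esum (E F : MeanPayoffExpr α) : MeanPayoffExpr α

namespace MeanPayoffExpr

variable {α : Type u}

/-- The quantitative language of a mean-payoff automaton expression. -/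
noncomputable def lang : MeanPayoffExpr.{u, v} α → (ℕ → α) → ℝ
  | atom mode A, x => mode.val (fun n => (A.runWeights x n : ℝ))
  | emax E F, x => max (lang E x) (lang F x)
  | emin E F, x => min (lang E x) (lang F x)
  | esum E F, x => lang E x + lang F x

/-- The occurrences of automata in an expression. -/
def Leaf : MeanPayoffExpr.{u, v} α → Type
  | atom _ _ => Unit
  | emax E F => Leaf E ⊕ Leaf F
  | emin E F => Leaf E ⊕ Leaf F
  | esum E F => Leaf E ⊕ Leaf F

instance instFiniteLeaf : (E : MeanPayoffExpr.{u, v} α) → Finite E.Leaf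
  | atom _ _ => inferInstanceAs (Finite Unit)
  | emax E F =>
    haveI := instFiniteLeaf E
    haveI := instFiniteLeaf F
    inferInstanceAs (Finite (E.Leaf ⊕ F.Leaf))
  | emin E F =>
    haveI := instFiniteLeaf E
    haveI := instFiniteLeaf F
    inferInstanceAs (Finite (E.Leaf ⊕ F.Leaf))
  | esum E F =>
    haveI := instFiniteLeaf E
    haveI := instFiniteLeaf F
    inferInstanceAs (Finite (E.Leaf ⊕ F.Leaf))

/-- The automaton at an occurrence. -/
def aut : (E : MeanPayoffExpr.{u, v} α) → E.Leaf → DetWeightedAutomaton.{u, v, 0} α ℚ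
  | atom _ A, _ => A
  | emax E _, Sum.inl i => aut E i
  | emax _ F, Sum.inr i => aut F i
  | emin E _, Sum.inl i => aut E i
  | emin _ F, Sum.inr i => aut F i
  | esum E _, Sum.inl i => aut E i
  | esum _ F, Sum.inr i => aut F i

/-- The synchronized product of the automata that occur in an expression; its weights are the
vectors of the weights of the components. -/
def product (E : MeanPayoffExpr.{u, v} α) : DetWeightedAutomaton.{u, v, 0} α (E.Leaf → ℚ) where
  State := (i : E.Leaf) → (E.aut i).State
  init := fun i => (E.aut i).init
  step q a := fun i => (E.aut i).step (q i) a
  wt q a := fun i => (E.aut i).wt (q i) a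

/-- The contribution of a set `C` of states of the product automaton to the value set of the
expression: the values of the words whose run is eventually inside `C`. -/
def valuesIn (E : MeanPayoffExpr.{u, v} α) (C : Set E.product.State) : Set ℝ :=
  {y | ∃ x : ℕ → α, (∀ᶠ n in atTop, E.product.run x n ∈ C) ∧ E.lang x = y}

end MeanPayoffExpr

/-- The threshold `η` is an isolated cut-point of the quantitative language `L`. -/
def IsIsolatedCutPoint {α : Type u} (L : (ℕ → α) → ℝ) (η : ℝ) : Prop :=
  ∃ ε : ℝ, 0 < ε ∧ ∀ x : ℕ → α, ε < |L x - η|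

/-- The cut-point language of the quantitative language `L` for the threshold `η`. -/
def cutPointLanguage {α : Type u} (L : (ℕ → α) → ℝ) (η : ℝ) : Set (ℕ → α) :=
  {x | η ≤ L x}

/-! Fix a reachable state `q` on a cycle of the product automaton, and let `P` be the closure of
`cycleMeans q`. It is compact because weights are bounded, and convex because two cycles through `q`
can be repeated in any rational proportion.

A run that stays in the scc of `q` has all limit points of its averages in `P`: closing a long path
to a cycle through `q` changes the total weight by a bounded amount
(`eventually_runAvg_near_cycleMeans`). Conversely, any sequence of points of `P` is tracked by the
averages of one run, which repeats suitable cycles for longer and longer (`exists_word_of_targets`).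
Hence the vectors of lower and upper limits that occur are exactly the coordinatewise minima and
maxima of families in `P` indexed by `Leaf × Bool`, one point for each extremum of each coordinate
(`exists_word_of_family`, `exists_family_of_word`).

The value set of the scc is therefore the image of a power of `P`, compact and convex, under a
continuous map: a compact interval of attained values. An isolated `η` is not a value, so each such
interval lies on one side of `η`. Every run settles in one scc, and the Büchi condition reads off
the side. -/

namespace DetWeightedAutomaton

/-! ### Finite words, cycle means and averages along runs -/

section Words

variable {α : Type u} {W : Type w} {ι : Type}

/-- The state that is reached from `q` by reading a finite word. -/
def stepList (A : DetWeightedAutomaton.{u, v, w} α W) (q : A.State) (l : List α) : A.State :=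
  l.foldl A.step q

/-- The sum of the weights along the path that reads a finite word from the state `q`. -/
def totalWeight (A : DetWeightedAutomaton.{u, v, 0} α (ι → ℚ)) (q : A.State) :
    List α → ι → ℝ
  | [], _ => 0
  | a :: l, i => (A.wt q a i : ℝ) + totalWeight A (A.step q a) l i

theorem stepList_cons (A : DetWeightedAutomaton.{u, v, w} α W) (q : A.State) (a : α)
    (l : List α) : A.stepList q (a :: l) = A.stepList (A.step q a) l := rfl

theorem stepList_append (A : DetWeightedAutomaton.{u, v, w} α W) (q : A.State) (l l' : List α) :
    A.stepList q (l ++ l') = A.stepList (A.stepList q l) l' :=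
  List.foldl_append

theorem stepList_flatten_replicate (A : DetWeightedAutomaton.{u, v, w} α W) {q : A.State}
    {l : List α} (h : A.stepList q l = q) (n : ℕ) :
    A.stepList q (List.replicate n l).flatten = q := by
  induction n with
  | zero => rfl
  | succ n ih => rw [List.replicate_succ, List.flatten_cons, stepList_append, h, ih]

theorem totalWeight_append (A : DetWeightedAutomaton.{u, v, 0} α (ι → ℚ)) (q : A.State)
    (l l' : List α) (i : ι) : A.totalWeight q (l ++ l') i =
      A.totalWeight q l i + A.totalWeight (A.stepList q l) l' i := by
  induction l generalizing q with
  | nil => simp [totalWeight, stepList]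
  | cons a l ih => simp only [List.cons_append, totalWeight, ih, stepList_cons, add_assoc]

theorem totalWeight_flatten_replicate (A : DetWeightedAutomaton.{u, v, 0} α (ι → ℚ))
    {q : A.State} {l : List α} (h : A.stepList q l = q) (n : ℕ) (i : ι) :
    A.totalWeight q (List.replicate n l).flatten i = n * A.totalWeight q l i := by
  induction n with
  | zero => simp [totalWeight]
  | succ n ih =>
    rw [List.replicate_succ, List.flatten_cons, totalWeight_append, h, ih]
    push_cast
    ring

theorem abs_totalWeight_le (A : DetWeightedAutomaton.{u, v, 0} α (ι → ℚ)) {B : ℝ}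
    (hB : ∀ q a i, |(A.wt q a i : ℝ)| ≤ B) (q : A.State) (l : List α) (i : ι) :
    |A.totalWeight q l i| ≤ B * l.length := by
  induction l generalizing q with
  | nil => simp [totalWeight]
  | cons a l ih =>
    simp only [totalWeight, List.length_cons, Nat.cast_add, Nat.cast_one]
    calc _ ≤ _ := abs_add_le _ _
      _ ≤ B + B * l.length := add_le_add (hB q a i) (ih _)
      _ = _ := by ring

theorem exists_wt_bound [Finite α] [Finite ι] (A : DetWeightedAutomaton.{u, v, 0} α (ι → ℚ)) :
    ∃ B : ℝ, 0 ≤ B ∧ ∀ q a i, |(A.wt q a i : ℝ)| ≤ B := by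
  obtain ⟨B, hB⟩ := (Set.finite_range
    fun t : A.State × α × ι => |(A.wt t.1 t.2.1 t.2.2 : ℝ)|).bddAbove
  exact ⟨max B 0, le_max_right _ _, fun q a i =>
    le_max_of_le_left (hB ⟨(q, a, i), rfl⟩)⟩

theorem reflTransGen_edge_iff (A : DetWeightedAutomaton.{u, v, w} α W) {p q : A.State} :
    Relation.ReflTransGen A.Edge p q ↔ ∃ l, A.stepList p l = q := by
  constructor
  · intro h
    induction h with
    | refl => exact ⟨[], rfl⟩
    | tail _ h ih =>
      obtain ⟨l, rfl⟩ := ih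
      obtain ⟨a, rfl⟩ := h
      exact ⟨l ++ [a], A.stepList_append _ _ _⟩
  · rintro ⟨l, rfl⟩
    induction l generalizing p with
    | nil => exact .refl
    | cons a l ih => exact .head ⟨a, rfl⟩ ih

theorem exists_cycle_of_transGen (A : DetWeightedAutomaton.{u, v, w} α W) {p q : A.State}
    (h : Relation.TransGen A.Edge p q) : ∃ l, l ≠ [] ∧ A.stepList p l = q := by
  obtain ⟨r, ⟨a, rfl⟩, h⟩ := Relation.TransGen.head'_iff.1 h
  obtain ⟨l, rfl⟩ := A.reflTransGen_edge_iff.1 h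
  exact ⟨a :: l, by simp, rfl⟩

theorem run_eq_stepList (A : DetWeightedAutomaton.{u, v, w} α W) (x : ℕ → α) (n : ℕ) :
    A.run x n = A.stepList A.init ((List.range n).map x) := by
  induction n with
  | zero => rfl
  | succ n ih => rw [List.range_succ, List.map_append, stepList_append, ← ih]; rfl

theorem sum_runWeights (A : DetWeightedAutomaton.{u, v, 0} α (ι → ℚ)) (x : ℕ → α) (n : ℕ)
    (i : ι) : ∑ k ∈ Finset.range n, (A.runWeights x k i : ℝ) =
      A.totalWeight A.init ((List.range n).map x) i := by
  induction n with
  | zero => simp [totalWeight]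
  | succ n ih =>
    rw [Finset.sum_range_succ, ih, List.range_succ, List.map_append, totalWeight_append,
      ← run_eq_stepList]
    simp [totalWeight, runWeights]

theorem mul_prefixAvg (s : ℕ → ℝ) (n : ℕ) :
    n * prefixAvg s n = ∑ i ∈ Finset.range n, s i := by
  rcases Nat.eq_zero_or_pos n with rfl | hn
  · simp
  · have : (n : ℝ) ≠ 0 := by positivity
    rw [prefixAvg]
    field_simp

/-- Coordinatewise averages of the vectors of weights along the run over `x`. -/
noncomputable def runAvg (A : DetWeightedAutomaton.{u, v, 0} α (ι → ℚ)) (x : ℕ → α) (n : ℕ)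
    (i : ι) : ℝ := prefixAvg (fun k => (A.runWeights x k i : ℝ)) n

theorem mul_runAvg (A : DetWeightedAutomaton.{u, v, 0} α (ι → ℚ)) (x : ℕ → α) (n : ℕ) (i : ι) :
    n * A.runAvg x n i = A.totalWeight A.init ((List.range n).map x) i := by
  rw [runAvg, mul_prefixAvg, sum_runWeights]

theorem abs_le_of_mul_eq {B c t : ℝ} {n : ℕ} (hn : 0 < n) (h : n * c = t) (ht : |t| ≤ B * n) :
    |c| ≤ B := by
  have h0 : (0 : ℝ) < n := by exact_mod_cast hn
  rw [← h, abs_mul, abs_of_pos h0, mul_comm] at ht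
  exact le_of_mul_le_mul_right ht h0

theorem abs_runAvg_le (A : DetWeightedAutomaton.{u, v, 0} α (ι → ℚ)) {B : ℝ} (hB0 : 0 ≤ B)
    (hB : ∀ q a i, |(A.wt q a i : ℝ)| ≤ B) (x : ℕ → α) (n : ℕ) (i : ι) :
    |A.runAvg x n i| ≤ B := by
  rcases Nat.eq_zero_or_pos n with rfl | hn
  · simpa [runAvg, prefixAvg] using hB0
  · refine abs_le_of_mul_eq hn (A.mul_runAvg x n i) ?_
    simpa using A.abs_totalWeight_le hB A.init ((List.range n).map x) i

/-- The average weight vectors of the cycles through `q`. -/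
def cycleMeans (A : DetWeightedAutomaton.{u, v, 0} α (ι → ℚ)) (q : A.State) : Set (ι → ℝ) :=
  {c | ∃ l, l ≠ [] ∧ A.stepList q l = q ∧ ∀ i, (l.length : ℝ) * c i = A.totalWeight q l i}

theorem exists_mem_cycleMeans (A : DetWeightedAutomaton.{u, v, 0} α (ι → ℚ)) {q : A.State}
    {l : List α} (hl : l ≠ []) (h : A.stepList q l = q) :
    ∃ c ∈ A.cycleMeans q, ∀ i, (l.length : ℝ) * c i = A.totalWeight q l i := by
  have h0 : (l.length : ℝ) ≠ 0 := by simpa using hl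
  have : ∀ i, (l.length : ℝ) * (A.totalWeight q l i / l.length) = A.totalWeight q l i :=
    fun i => mul_div_cancel₀ _ h0
  exact ⟨_, ⟨l, hl, h, this⟩, this⟩

theorem abs_le_of_mem_cycleMeans (A : DetWeightedAutomaton.{u, v, 0} α (ι → ℚ)) {B : ℝ}
    (hB : ∀ q a i, |(A.wt q a i : ℝ)| ≤ B) {q : A.State} {c : ι → ℝ}
    (hc : c ∈ A.cycleMeans q) (i : ι) : |c i| ≤ B := by
  obtain ⟨l, hl, -, h⟩ := hc
  exact abs_le_of_mul_eq (List.length_pos_of_ne_nil hl) (h i) (A.abs_totalWeight_le hB _ _ _)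

theorem isCompact_closure_cycleMeans [Finite α] [Finite ι]
    (A : DetWeightedAutomaton.{u, v, 0} α (ι → ℚ)) (q : A.State) :
    IsCompact (closure (A.cycleMeans q)) := by
  obtain ⟨B, -, hB⟩ := A.exists_wt_bound
  refine (isCompact_univ_pi fun _ : ι => isCompact_Icc (a := -B) (b := B)).closure_of_subset ?_
  exact fun c hc i _ => abs_le.1 (A.abs_le_of_mem_cycleMeans hB hc i)

/-- Multiplying the number of copies of each cycle by the length of the other makes the two blocks
have lengths in the ratio `m : n - m`. -/
theorem combo_mem_cycleMeans (A : DetWeightedAutomaton.{u, v, 0} α (ι → ℚ)) {q : A.State}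
    {c d : ι → ℝ} (hc : c ∈ A.cycleMeans q) (hd : d ∈ A.cycleMeans q) {m n : ℕ} (hmn : m ≤ n)
    (hn : 0 < n) : ((m : ℝ) / n) • c + (1 - (m : ℝ) / n) • d ∈ A.cycleMeans q := by
  obtain ⟨l, hl, hlq, hlw⟩ := hc
  obtain ⟨r, hr, hrq, hrw⟩ := hd
  obtain ⟨k, rfl⟩ := Nat.exists_eq_add_of_le hmn
  have hl0 := List.length_pos_of_ne_nil hl
  have hr0 := List.length_pos_of_ne_nil hr
  have hlen : ((List.replicate (m * r.length) l).flatten ++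
      (List.replicate (k * l.length) r).flatten).length = (m + k) * (l.length * r.length) := by
    simp only [List.length_append, List.length_flatten, List.map_replicate, List.sum_replicate,
      smul_eq_mul]
    ring
  refine ⟨(List.replicate (m * r.length) l).flatten ++ (List.replicate (k * l.length) r).flatten,
    ?_, ?_, fun i => ?_⟩
  · rw [← List.length_pos_iff, hlen]
    positivity
  · rw [stepList_append, A.stepList_flatten_replicate hlq, A.stepList_flatten_replicate hrq]
  · rw [totalWeight_append, A.stepList_flatten_replicate hlq, A.totalWeight_flatten_replicate hlq,
      A.totalWeight_flatten_replicate hrq, ← hlw, ← hrw, hlen]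
    have h0 : (m : ℝ) + k ≠ 0 := by exact_mod_cast hn.ne'
    simp only [Pi.add_apply, Pi.smul_apply, smul_eq_mul]
    push_cast
    field_simp
    ring

theorem convex_closure_cycleMeans (A : DetWeightedAutomaton.{u, v, 0} α (ι → ℚ)) (q : A.State) :
    Convex ℝ (closure (A.cycleMeans q)) := by
  have key : ∀ t : ℝ, 0 ≤ t → t ≤ 1 → ∀ c ∈ A.cycleMeans q, ∀ d ∈ A.cycleMeans q,
      t • c + (1 - t) • d ∈ closure (A.cycleMeans q) := by
    intro t ht0 ht1 c hc d hd
    -- Real proportions are limits of the rational ones that cycles realize.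
    have hlim : Tendsto (fun n : ℕ => ((⌊t * n⌋₊ : ℝ) / n)) atTop (nhds t) :=
      (tendsto_nat_floor_mul_div_atTop ht0).comp tendsto_natCast_atTop_atTop
    have hcont : Continuous fun s : ℝ => s • c + (1 - s) • d := by fun_prop
    refine mem_closure_of_tendsto ((hcont.tendsto t).comp hlim) ?_
    filter_upwards [eventually_gt_atTop 0] with n hn
    refine A.combo_mem_cycleMeans hc hd (Nat.floor_le_of_le ?_) hn
    exact mul_le_of_le_one_left n.cast_nonneg ht1
  intro c hc d hd a b ha hb hab
  obtain rfl : b = 1 - a := by linarith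
  have := map_mem_closure₂ (f := fun c d : ι → ℝ => a • c + (1 - a) • d) (by fun_prop) hc hd
    (key a ha (by linarith))
  rwa [closure_closure] at this

theorem eventually_runAvg_near_cycleMeans [Finite α] [Finite ι]
    (A : DetWeightedAutomaton.{u, v, 0} α (ι → ℚ)) (q : A.State) {x : ℕ → α}
    (hx : ∀ᶠ n in atTop, A.run x n ∈ A.scc q) {ε : ℝ} (hε : 0 < ε) :
    ∀ᶠ n in atTop, ∃ c ∈ A.cycleMeans q, ∀ i, |A.runAvg x n i - c i| ≤ ε := by
  obtain ⟨B, hB0, hB⟩ := A.exists_wt_bound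
  obtain ⟨N, hN⟩ := eventually_atTop.1 hx
  obtain ⟨s, hs⟩ := A.reflTransGen_edge_iff.1 (hN N le_rfl).1
  -- Return words to `q`, with a dummy value outside the scc; there are finitely many states, so
  -- their lengths are bounded by one `K`.
  have hg : ∀ p, ∃ l, p ∈ A.scc q → A.stepList p l = q := fun p => by
    by_cases h : p ∈ A.scc q
    · obtain ⟨l, hl⟩ := A.reflTransGen_edge_iff.1 h.2
      exact ⟨l, fun _ => hl⟩
    · exact ⟨[], fun h' => (h h').elim⟩
  choose g hg using hg
  obtain ⟨K, hK⟩ := (Set.finite_range fun p => (g p).length).bddAbove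
  replace hK : ∀ p, (g p).length ≤ K := fun p => hK ⟨p, rfl⟩
  -- The prefix of length `N` is replaced by `s`, and a return word is appended. The weights of
  -- these pieces and the change of length times `c i` each contribute at most `B * (s.length + N +
  -- K)`.
  have hlarge : ∀ᶠ n : ℕ in atTop, 2 * B * (s.length + N + K) / ε ≤ (n : ℝ) :=
    tendsto_natCast_atTop_atTop.eventually_ge_atTop _
  filter_upwards [eventually_gt_atTop N, hlarge] with n hnN hn
  obtain ⟨k, rfl⟩ := Nat.exists_eq_add_of_le hnN.le
  rw [div_le_iff₀ hε] at hn
  have hpre : (List.range (N + k)).map x =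
      (List.range N).map x ++ (List.range k).map (fun j => x (N + j)) := by
    rw [List.range_add, List.map_append, List.map_map]
    rfl
  have hrun : A.stepList (A.run x N) ((List.range k).map fun j => x (N + j)) =
      A.run x (N + k) := by
    rw [run_eq_stepList, ← stepList_append, ← hpre, ← run_eq_stepList]
  set t := (List.range k).map fun j => x (N + j) with ht
  have htl : t.length = k := by simp [ht]
  set r := g (A.run x (N + k)) with hr
  have hcyc : A.stepList q (s ++ (t ++ r)) = q := by
    rw [stepList_append, hs, stepList_append, hrun]
    exact hg _ (hN _ (by omega))
  have hne : s ++ (t ++ r) ≠ [] := by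
    rw [← List.length_pos_iff]
    simp only [List.length_append]
    omega
  obtain ⟨c, hc, hcw⟩ := A.exists_mem_cycleMeans hne hcyc
  refine ⟨c, hc, fun i => ?_⟩
  have h1 := A.mul_runAvg x (N + k) i
  have h2 := hcw i
  rw [hpre, totalWeight_append, ← run_eq_stepList] at h1
  rw [totalWeight_append, hs, totalWeight_append, hrun] at h2
  have b1 := abs_le.1 (A.abs_totalWeight_le hB A.init ((List.range N).map x) i)
  have b2 := abs_le.1 (A.abs_totalWeight_le hB q s i)
  have b3 := abs_le.1 (A.abs_totalWeight_le hB (A.run x (N + k)) r i)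
  have b4 := A.abs_le_of_mem_cycleMeans hB hc i
  have hrK : (r.length : ℝ) ≤ K := by exact_mod_cast hK _
  have hBK := mul_le_mul_of_nonneg_left hrK hB0
  simp only [List.length_append, htl, List.length_map, List.length_range] at h2 b1
  push_cast at h1 h2 hn
  have hpos : (0 : ℝ) < N + k := by
    have : 0 < N + k := by omega
    exact_mod_cast this
  have hdiff : |((s.length : ℝ) + r.length - N) * c i| ≤ (s.length + N + K) * B := by
    rw [abs_mul]
    refine mul_le_mul ?_ b4 (abs_nonneg _) (by positivity)
    rw [abs_le]
    constructor <;> nlinarith [s.length.cast_nonneg (α := ℝ), r.length.cast_nonneg (α := ℝ),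
      N.cast_nonneg (α := ℝ)]
  have hd := abs_le.1 hdiff
  have : |((N : ℝ) + k) * (A.runAvg x (N + k) i - c i)| ≤ ε * (N + k) := by
    rw [abs_le]
    constructor <;> linarith
  rw [abs_mul, abs_of_pos hpos, mul_comm] at this
  exact le_of_mul_le_mul_right this hpos

end Words

end DetWeightedAutomaton

/-! ### Lower and upper limits of real sequences, limit points of vectors -/

section RealSequences

theorem liminf_eq_of_eventually_of_frequently {a : ℕ → ℝ} {y : ℝ}
    (h₁ : ∀ ε > 0, ∀ᶠ n in atTop, y - ε ≤ a n) (h₂ : ∀ ε > 0, ∃ᶠ n in atTop, a n ≤ y + ε) :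
    liminf a atTop = y := by
  have hb : IsBoundedUnder (· ≥ ·) atTop a := ⟨y - 1, h₁ 1 one_pos⟩
  have hc : IsCoboundedUnder (· ≥ ·) atTop a :=
    IsCoboundedUnder.of_frequently_le (h₂ 1 one_pos)
  apply le_antisymm
  · exact le_of_forall_pos_le_add fun ε hε => liminf_le_of_frequently_le (h₂ ε hε) hb
  · exact le_of_forall_pos_le_add fun ε hε =>
      sub_le_iff_le_add.1 (le_liminf_of_le hc (h₁ ε hε))

theorem limsup_eq_of_eventually_of_frequently {a : ℕ → ℝ} {y : ℝ}
    (h₁ : ∀ ε > 0, ∀ᶠ n in atTop, a n ≤ y + ε) (h₂ : ∀ ε > 0, ∃ᶠ n in atTop, y - ε ≤ a n) :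
    limsup a atTop = y := by
  have hb : IsBoundedUnder (· ≤ ·) atTop a := ⟨y + 1, h₁ 1 one_pos⟩
  have hc : IsCoboundedUnder (· ≤ ·) atTop a :=
    IsCoboundedUnder.of_frequently_ge (h₂ 1 one_pos)
  apply le_antisymm
  · exact le_of_forall_pos_le_add fun ε hε => limsup_le_of_le hc (h₁ ε hε)
  · exact le_of_forall_pos_le_add fun ε hε =>
      sub_le_iff_le_add.1 (le_limsup_of_frequently_le (h₂ ε hε) hb)

theorem isBoundedUnder_of_abs_le {a : ℕ → ℝ} {B : ℝ} (h : ∀ n, |a n| ≤ B) :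
    IsBoundedUnder (· ≤ ·) atTop a ∧ IsBoundedUnder (· ≥ ·) atTop a :=
  ⟨isBoundedUnder_of ⟨B, fun n => (abs_le.1 (h n)).2⟩,
    isBoundedUnder_of ⟨-B, fun n => (abs_le.1 (h n)).1⟩⟩

theorem frequently_abs_sub_liminf_le {a : ℕ → ℝ} {B : ℝ} (h : ∀ n, |a n| ≤ B) {ε : ℝ}
    (hε : 0 < ε) : ∃ᶠ n in atTop, |a n - liminf a atTop| ≤ ε := by
  obtain ⟨hu, hl⟩ := isBoundedUnder_of_abs_le h
  have h₁ := frequently_lt_of_liminf_lt hu.isCoboundedUnder_ge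
    (lt_add_of_pos_right (liminf a atTop) hε)
  have h₂ := eventually_lt_of_lt_liminf (sub_lt_self (liminf a atTop) hε) hl
  refine (h₁.and_eventually h₂).mono fun n hn => ?_
  rw [abs_le]
  constructor <;> linarith [hn.1, hn.2]

theorem frequently_abs_sub_limsup_le {a : ℕ → ℝ} {B : ℝ} (h : ∀ n, |a n| ≤ B) {ε : ℝ}
    (hε : 0 < ε) : ∃ᶠ n in atTop, |a n - limsup a atTop| ≤ ε := by
  obtain ⟨hu, hl⟩ := isBoundedUnder_of_abs_le h
  have h₁ := frequently_lt_of_lt_limsup hl.isCoboundedUnder_le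
    (sub_lt_self (limsup a atTop) hε)
  have h₂ := eventually_lt_of_limsup_lt (lt_add_of_pos_right (limsup a atTop) hε) hu
  refine (h₁.and_eventually h₂).mono fun n hn => ?_
  rw [abs_le]
  constructor <;> linarith [hn.1, hn.2]

/-- A value that one coordinate of a bounded sequence of vectors approaches infinitely often is the
coordinate of a limit point of the sequence. -/
theorem exists_mem_closure_of_frequently {ι : Type} [Finite ι] {a : ℕ → ι → ℝ} {B : ℝ}
    (ha : ∀ n i, |a n i| ≤ B) {S : Set (ι → ℝ)}
    (hS : ∀ ε > 0, ∀ᶠ n in atTop, ∃ c ∈ S, ∀ i, |a n i - c i| ≤ ε) {j : ι} {y : ℝ}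
    (hy : ∀ ε > 0, ∃ᶠ n in atTop, |a n j - y| ≤ ε) :
    ∃ z ∈ closure S, z j = y ∧ ∀ i, liminf (fun n => a n i) atTop ≤ z i ∧
      z i ≤ limsup (fun n => a n i) atTop := by
  cases nonempty_fintype ι
  have hpos : ∀ k : ℕ, (0 : ℝ) < 1 / (k + 1) := fun k => Nat.one_div_pos_of_nat
  -- Along `φ` the averages approach `S` and their coordinate `j` approaches `y`; boundedness then
  -- gives a convergent subsequence.
  obtain ⟨φ, hφ, hφy⟩ := extraction_forall_of_frequently fun k : ℕ =>
    (hy _ (hpos k)).and_eventually (hS _ (hpos k))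
  obtain ⟨z, -, ψ, hψ, hz⟩ := tendsto_subseq_of_bounded
    (isCompact_univ_pi fun _ : ι => isCompact_Icc (a := -B) (b := B)).isBounded
    (x := a ∘ φ) fun n i _ => abs_le.1 (ha _ i)
  have hzi : ∀ i, Tendsto (fun k => a (φ (ψ k)) i) atTop (nhds (z i)) := fun i =>
    (tendsto_pi_nhds.1 hz i)
  have hsub : Tendsto (fun k => φ (ψ k)) atTop atTop :=
    hφ.tendsto_atTop.comp hψ.tendsto_atTop
  have hzero : Tendsto (fun k => 1 / ((ψ k : ℝ) + 1)) atTop (nhds 0) :=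
    tendsto_one_div_add_atTop_nhds_zero_nat.comp hψ.tendsto_atTop
  choose hφ1 c hcS hc using hφy
  refine ⟨z, mem_closure_of_tendsto (f := fun k => c (ψ k)) (b := atTop) ?_
    (.of_forall fun k => hcS _), ?_, fun i => ⟨?_, ?_⟩⟩
  · refine tendsto_pi_nhds.2 fun i => ?_
    have : Tendsto (fun k => a (φ (ψ k)) i - c (ψ k) i) atTop (nhds 0) :=
      squeeze_zero_norm (fun k => hc (ψ k) i) hzero
    simpa using (hzi i).sub this
  · have : Tendsto (fun k => a (φ (ψ k)) j - y) atTop (nhds 0) :=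
      squeeze_zero_norm (fun k => hφ1 (ψ k)) hzero
    exact sub_eq_zero.1 (tendsto_nhds_unique ((hzi j).sub_const y) this)
  · refine le_of_forall_lt fun b hb => ?_
    obtain ⟨b', hbb, hb'⟩ := exists_between hb
    exact hbb.trans_le (ge_of_tendsto (hzi i) ((hsub.eventually (eventually_lt_of_lt_liminf hb'
      (isBoundedUnder_of_abs_le fun n => ha n i).2)).mono fun _ h => h.le))
  · refine le_of_forall_gt fun b hb => ?_
    obtain ⟨b', hb', hbb⟩ := exists_between hb
    exact (le_of_tendsto (hzi i) ((hsub.eventually (eventually_lt_of_limsup_lt hb'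
      (isBoundedUnder_of_abs_le fun n => ha n i).1)).mono fun _ h => h.le)).trans_lt hbb

/-- A schedule for visiting each member of a finite family infinitely often: the first component of
`Nat.unpair` takes each value at arbitrarily large arguments. -/
theorem exists_frequently_eq (κ : Type) [Finite κ] [Nonempty κ] :
    ∃ f : ℕ → κ, ∀ j, ∃ᶠ m in atTop, f m = j := by
  obtain ⟨g, hg⟩ := exists_surjective_nat κ
  refine ⟨fun m => g (Nat.unpair m).1, fun j => frequently_atTop.2 fun N => ?_⟩
  obtain ⟨k, rfl⟩ := hg j
  exact ⟨Nat.pair k N, Nat.right_le_pair k N, by simp⟩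

end RealSequences

/-! ### Limits of growing finite words -/

section Prefixes

variable {α : Type u}

/-- A sequence of finite words of increasing lengths, each a prefix of the next, has a limit. -/
theorem exists_limit_word {h : ℕ → List α} (hp : ∀ m, h m <+: h (m + 1))
    (hl : ∀ m, (h m).length < (h (m + 1)).length) :
    ∃ x : ℕ → α, ∀ m n, n ≤ (h m).length → (List.range n).map x = (h m).take n := by
  have hmono : StrictMono fun m => (h m).length := strictMono_nat_of_lt_succ hl
  have hpre : ∀ {m n}, m ≤ n → h m <+: h n := fun {m n} hmn => by
    induction hmn with
    | refl => exact List.prefix_rfl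
    | step _ ih => exact ih.trans (hp _)
  have hlen : ∀ n, n < (h (n + 1)).length := fun n => hmono.id_le (n + 1)
  refine ⟨fun n => (h (n + 1))[n]'(hlen n), fun m n hn => ?_⟩
  refine List.ext_getElem (by simpa using hn) fun k h₁ h₂ => ?_
  simp only [List.length_map, List.length_range] at h₁
  simp only [List.getElem_map, List.getElem_range, List.getElem_take]
  rcases le_total (k + 1) m with hkm | hkm
  · exact (hpre hkm).getElem _
  · exact ((hpre hkm).getElem _).symm

end Prefixes

/-! ### Realizing prescribed limit points by runs, and the converse -/

namespace DetWeightedAutomaton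

section Realization

variable {α : Type u} {ι : Type}

/-- Complete copies of the cycle contribute exactly their mean. Only the last, incomplete copy
deviates, by at most `B * l.length` for its weight and as much for its share of the mean. -/
theorem abs_totalWeight_take_flatten_replicate_sub_le
    (A : DetWeightedAutomaton.{u, v, 0} α (ι → ℚ)) {B : ℝ}
    (hB : ∀ q a i, |(A.wt q a i : ℝ)| ≤ B) {q : A.State} {l : List α} (hl : A.stepList q l = q)
    {c : ι → ℝ} (hc : ∀ i, (l.length : ℝ) * c i = A.totalWeight q l i) {i : ι}
    (hcB : |c i| ≤ B) (n k : ℕ) (hk : k ≤ n * l.length) :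
    |A.totalWeight q ((List.replicate n l).flatten.take k) i - k * c i| ≤ 2 * B * l.length := by
  have hB0 : 0 ≤ B := (abs_nonneg _).trans hcB
  induction n generalizing k with
  | zero =>
    obtain rfl : k = 0 := by simpa using hk
    simpa [totalWeight] using by positivity
  | succ n ih =>
    rw [List.replicate_succ, List.flatten_cons]
    rcases le_total k l.length with h | h
    · rw [List.take_append_of_le_length h]
      have h₁ := A.abs_totalWeight_le hB q (l.take k) i
      rw [List.length_take, min_eq_left h] at h₁
      have h₂ : |(k : ℝ) * c i| ≤ B * k := by
        rw [abs_mul, Nat.abs_cast, mul_comm]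
        exact mul_le_mul_of_nonneg_right hcB k.cast_nonneg
      have h₃ : B * k ≤ B * l.length :=
        mul_le_mul_of_nonneg_left (by exact_mod_cast h) hB0
      calc _ ≤ _ := abs_sub _ _
        _ ≤ 2 * B * l.length := by linarith
    · obtain ⟨k, rfl⟩ := Nat.exists_eq_add_of_le h
      rw [List.take_length_add_append, totalWeight_append, hl, ← hc]
      have := ih k (by rw [add_mul, one_mul] at hk; omega)
      convert this using 2
      push_cast
      ring

/-- Any sequence of limits of cycle means can be followed by the averages along a run. -/
theorem exists_word_of_targets [Finite α] [Finite ι]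
    (A : DetWeightedAutomaton.{u, v, 0} α (ι → ℚ)) {q : A.State}
    (hq : Relation.ReflTransGen A.Edge A.init q) {T : ℕ → ι → ℝ}
    (hT : ∀ m, T m ∈ closure (A.cycleMeans q)) :
    ∃ (x : ℕ → α) (p : ℕ → ℕ) (δ : ℕ → ℝ), (∀ᶠ n in atTop, A.run x n ∈ A.scc q) ∧
      StrictMono p ∧ Tendsto δ atTop (nhds 0) ∧
      (∀ m i, |A.runAvg x (p m) i - T m i| ≤ δ m) ∧
      ∀ m n, p m ≤ n → n ≤ p (m + 1) → ∀ i,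
        min (T m i) (T (m + 1) i) - δ m ≤ A.runAvg x n i ∧
          A.runAvg x n i ≤ max (T m i) (T (m + 1) i) + δ m := by
  cases nonempty_fintype ι
  obtain ⟨B, hB0, hB⟩ := A.exists_wt_bound
  have hpos : ∀ k : ℕ, (0 : ℝ) < 1 / (k + 1) := fun k => Nat.one_div_pos_of_nat
  have hex : ∀ m, ∃ c ∈ A.cycleMeans q, ∀ i, |c i - T m i| ≤ 1 / ((m : ℝ) + 1) := fun m => by
    obtain ⟨c, hc, hd⟩ := Metric.mem_closure_iff.1 (hT m) _ (hpos m)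
    refine ⟨c, hc, fun i => ?_⟩
    rw [abs_sub_comm, ← Real.dist_eq]
    exact (dist_le_pi_dist _ _ i).trans hd.le
  choose c hc hcT using hex
  have hcB : ∀ m i, |c m i| ≤ B := fun m i => A.abs_le_of_mem_cycleMeans hB (hc m) i
  choose l hl hlq hlc using hc
  obtain ⟨s, hs⟩ := A.reflTransGen_edge_iff.1 hq
  -- `N` repetitions of `l m` make the new word so long that the history `h` and a single copy of
  -- the next cycle are negligible, up to `1 / (m + 1)` of its length.
  have hN : ∀ (h : List α) (m : ℕ), ∃ N : ℕ, 0 < N ∧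
      2 * B * ((l (m + 1)).length + h.length) * (m + 1) ≤ h.length + N * (l m).length := by
    intro h m
    obtain ⟨N, hN⟩ := exists_nat_ge (2 * B * ((l (m + 1)).length + h.length) * ((m : ℝ) + 1))
    refine ⟨N + 1, N.succ_pos, hN.trans ?_⟩
    have h1 : (1 : ℝ) ≤ (l m).length := by
      exact_mod_cast List.length_pos_of_ne_nil (hl m)
    push_cast
    nlinarith [h.length.cast_nonneg (α := ℝ), N.cast_nonneg (α := ℝ)]
  choose N hN0 hN using hN
  obtain ⟨h, h0, hsucc⟩ : ∃ h : ℕ → List α, h 0 = s ∧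
      ∀ m, h (m + 1) = h m ++ (List.replicate (N (h m) m) (l m)).flatten :=
    ⟨fun m => Nat.rec s (fun m h => h ++ (List.replicate (N h m) (l m)).flatten) m,
      rfl, fun _ => rfl⟩
  have hlen : ∀ m, (h (m + 1)).length = (h m).length + N (h m) m * (l m).length := fun m => by
    rw [hsucc]; simp
  have hlt : ∀ m, (h m).length < (h (m + 1)).length := fun m => by
    rw [hlen]
    exact Nat.lt_add_of_pos_right (Nat.mul_pos (hN0 _ _) (List.length_pos_of_ne_nil (hl m)))
  have hstate : ∀ m, A.stepList A.init (h m) = q := fun m => by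
    induction m with
    | zero => rw [h0, hs]
    | succ m ih => rw [hsucc, stepList_append, ih, A.stepList_flatten_replicate (hlq m)]
  have hmono : StrictMono fun m => (h m).length := strictMono_nat_of_lt_succ hlt
  obtain ⟨x, hx⟩ := exists_limit_word (fun m => ⟨_, (hsucc m).symm⟩) hlt
  have hwt : ∀ m i, ((h m).length : ℝ) * A.runAvg x (h m).length i =
      A.totalWeight A.init (h m) i := fun m i => by
    rw [mul_runAvg, hx m _ le_rfl, List.take_length]
  have hend : ∀ m i, |((h (m + 1)).length : ℝ) * (A.runAvg x (h (m + 1)).length i - c m i)| ≤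
      (1 / ((m : ℝ) + 1)) * (h (m + 1)).length := by
    intro m i
    have h1 := hwt (m + 1) i
    rw [hsucc, totalWeight_append, hstate, A.totalWeight_flatten_replicate (hlq m), ← hlc m,
      ← hsucc] at h1
    have h2 : ((h (m + 1)).length : ℝ) * (A.runAvg x (h (m + 1)).length i - c m i) =
        A.totalWeight A.init (h m) i - (h m).length * c m i := by
      rw [mul_sub, h1, hlen]
      push_cast
      ring
    have h3 : |((h m).length : ℝ) * c m i| ≤ B * (h m).length := by
      rw [abs_mul, Nat.abs_cast, mul_comm]
      exact mul_le_mul_of_nonneg_right (hcB m i) (Nat.cast_nonneg _)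
    have h4 := hN (h m) m
    rw [h2, one_div_mul_eq_div, le_div_iff₀ (by positivity), hlen]
    push_cast
    refine le_trans (mul_le_mul_of_nonneg_right ?_ (by positivity)) h4
    calc _ ≤ _ := abs_sub _ _
      _ ≤ 2 * B * ((l (m + 1)).length + (h m).length) := by
        have := A.abs_totalWeight_le hB A.init (h m) i
        have := mul_nonneg hB0 (l (m + 1)).length.cast_nonneg (α := ℝ)
        linarith
  have hlen0 : ∀ m, (0 : ℝ) < (h (m + 1)).length := fun m => by
    exact_mod_cast (Nat.zero_le _).trans_lt (hlt m)
  have hend' : ∀ m i, |A.runAvg x (h (m + 1)).length i - c m i| ≤ 1 / ((m : ℝ) + 1) := by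
    intro m i
    have := hend m i
    rw [abs_mul, Nat.abs_cast, mul_comm] at this
    exact le_of_mul_le_mul_right this (hlen0 m)
  -- The block of `l m` ends at the length of `h (m + 1)`, hence the shift. The factor 3 covers the
  -- distance from cycle mean to target, the history, and an incomplete copy of the next cycle.
  refine ⟨x, fun m => (h (m + 1)).length, fun m => 3 * (1 / ((m : ℝ) + 1)), ?_,
    fun a b hab => hmono (Nat.succ_lt_succ hab), ?_, fun m i => ?_,
    fun m n hmn hnm i => ?_⟩
  -- A prefix at least as long as `s` lies between two visits to `q`: one after `s`, the other at
  -- the end of `h n`.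
  · filter_upwards [eventually_ge_atTop s.length] with n hn
    have hn' : n ≤ (h n).length := hmono.id_le n
    have hpre : (List.range n).map x = s ++ ((h n).take n).drop s.length := by
      have : s = ((h n).take n).take s.length := by
        rw [← hx n n hn', ← List.map_take, List.take_range, min_eq_left hn]
        rw [hx 0 s.length (by rw [h0]), h0, List.take_length]
      conv_rhs => rw [this]
      rw [hx n n hn', List.length_take, List.length_take]
      rw [min_eq_left (by rwa [min_eq_left hn'])]
      exact (List.take_append_drop _ _).symm
    constructor
    · rw [run_eq_stepList, hpre, stepList_append, hs]
      exact A.reflTransGen_edge_iff.2 ⟨_, rfl⟩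
    · rw [run_eq_stepList, hx n n hn']
      refine A.reflTransGen_edge_iff.2 ⟨(h n).drop n, ?_⟩
      rw [← stepList_append, List.take_append_drop, hstate]
  · simpa using tendsto_one_div_add_atTop_nhds_zero_nat.const_mul (3 : ℝ)
  · have := abs_le.1 (hend' m i)
    have := abs_le.1 (hcT m i)
    have := hpos m
    rw [abs_le]
    constructor <;> linarith
  · dsimp only at hmn hnm ⊢
    obtain ⟨k, rfl⟩ := Nat.exists_eq_add_of_le hmn
    have hk : k ≤ N (h (m + 1)) (m + 1) * (l (m + 1)).length := by
      have := hlen (m + 1)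
      omega
    have hn := A.mul_runAvg x ((h (m + 1)).length + k) i
    rw [hx (m + 1 + 1) _ hnm, hsucc (m + 1), List.take_length_add_append, totalWeight_append, hstate,
      ← hwt] at hn
    have h1 := abs_le.1 (A.abs_totalWeight_take_flatten_replicate_sub_le hB (hlq (m + 1))
      (hlc (m + 1)) (hcB (m + 1) i) _ _ hk)
    have h2 : 2 * B * (l (m + 1)).length ≤ (1 / ((m : ℝ) + 1)) * (h (m + 1)).length := by
      rw [one_div_mul_eq_div, le_div_iff₀ (by positivity), hlen]
      push_cast
      refine le_trans (mul_le_mul_of_nonneg_right ?_ (by positivity)) (hN (h m) m)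
      exact mul_le_mul_of_nonneg_left (by simp) (by positivity)
    have h3 := abs_le.1 (hend m i)
    have h4 := abs_le.1 (hcT m i)
    have h5 := abs_le.1 (hcT (m + 1) i)
    have h6 : 1 / (((m + 1 : ℕ) : ℝ) + 1) ≤ 1 / ((m : ℝ) + 1) :=
      one_div_le_one_div_of_le (by positivity) (by push_cast; linarith)
    have hm := hpos m
    set d := 1 / ((m : ℝ) + 1) with hd
    have hH := hlen0 m
    set H : ℝ := ((h (m + 1)).length : ℝ) with hHdef
    push_cast at hn
    rw [← hHdef] at hn
    have hk0 : (0 : ℝ) ≤ k := k.cast_nonneg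
    have hdk := mul_nonneg hm.le hk0
    -- Up to these errors, the average at time `H + k` is the convex combination of `c m` and `c (m
    -- + 1)` with weights proportional to `H` and `k`.
    constructor
    · have e1 : H * (min (T m i) (T (m + 1) i) - d) ≤ H * c m i :=
        mul_le_mul_of_nonneg_left (by linarith [min_le_left (T m i) (T (m + 1) i)]) hH.le
      have e2 : k * (min (T m i) (T (m + 1) i) - d) ≤ k * c (m + 1) i :=
        mul_le_mul_of_nonneg_left (by linarith [min_le_right (T m i) (T (m + 1) i)]) hk0
      refine le_of_mul_le_mul_left ?_ (add_pos_of_pos_of_nonneg hH hk0)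
      rw [hn]
      linarith
    · have e1 : H * c m i ≤ H * (max (T m i) (T (m + 1) i) + d) :=
        mul_le_mul_of_nonneg_left (by linarith [le_max_left (T m i) (T (m + 1) i)]) hH.le
      have e2 : k * c (m + 1) i ≤ k * (max (T m i) (T (m + 1) i) + d) :=
        mul_le_mul_of_nonneg_left (by linarith [le_max_right (T m i) (T (m + 1) i)]) hk0
      refine le_of_mul_le_mul_left ?_ (add_pos_of_pos_of_nonneg hH hk0)
      rw [hn]
      linarith

/-- Any finite family of limits of cycle means is the family of the extreme limit points of the
averages along some run. -/
theorem exists_word_of_family [Finite α] [Finite ι]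
    (A : DetWeightedAutomaton.{u, v, 0} α (ι → ℚ)) {q : A.State}
    (hq : Relation.ReflTransGen A.Edge A.init q) {κ : Type} [Fintype κ] [Nonempty κ]
    {z : κ → ι → ℝ} (hz : ∀ j, z j ∈ closure (A.cycleMeans q)) :
    ∃ x : ℕ → α, (∀ᶠ n in atTop, A.run x n ∈ A.scc q) ∧ ∀ i,
      liminf (fun n => A.runAvg x n i) atTop =
        Finset.univ.inf' Finset.univ_nonempty (fun j => z j i) ∧
      limsup (fun n => A.runAvg x n i) atTop =
        Finset.univ.sup' Finset.univ_nonempty (fun j => z j i) := by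
  obtain ⟨f, hf⟩ := exists_frequently_eq κ
  obtain ⟨x, p, δ, hx, hp, hδ, hpT, hbet⟩ :=
    A.exists_word_of_targets hq (T := fun m => z (f m)) fun m => hz _
  refine ⟨x, hx, fun i => ?_⟩
  have hev : ∀ ε > 0, ∀ᶠ n in atTop,
      ∃ m, p m ≤ n ∧ n ≤ p (m + 1) ∧ δ m ≤ ε := by
    intro ε hε
    obtain ⟨M, hM⟩ := eventually_atTop.1 (hδ.eventually_le_const hε)
    filter_upwards [eventually_ge_atTop (p M)] with n hn
    -- The least index whose `p` exceeds `n` is the right end of the block containing `n`.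
    have hgt : ∃ m, n < p m := ⟨n + 1, hp.id_le (n + 1)⟩
    classical
    have hspec := Nat.find_spec hgt
    have hMlt : M < Nat.find hgt := by
      by_contra hcon
      exact absurd (hp.monotone (not_lt.1 hcon)) (by omega)
    obtain ⟨m, hm⟩ := Nat.exists_eq_add_of_lt hMlt
    rw [hm] at hspec
    refine ⟨M + m, not_lt.1 (Nat.find_min hgt (by omega)), hspec.le, hM _ (by omega)⟩
  have hfr : ∀ j, ∀ ε > 0, ∃ᶠ n in atTop, |A.runAvg x n i - z j i| ≤ ε := by
    intro j ε hε
    refine hp.tendsto_atTop.frequently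
      (((hf j).and_eventually (hδ.eventually_le_const hε)).mono fun m hm => ?_)
    rw [← hm.1]
    exact (hpT m i).trans hm.2
  constructor
  · obtain ⟨j, -, hj⟩ := Finset.exists_mem_eq_inf' Finset.univ_nonempty fun j => z j i
    refine liminf_eq_of_eventually_of_frequently (fun ε hε => ?_) fun ε hε => ?_
    · filter_upwards [hev ε hε] with n ⟨m, h1, h2, h3⟩
      have := (hbet m n h1 h2 i).1
      have : Finset.univ.inf' Finset.univ_nonempty (fun j => z j i) ≤
          min (z (f m) i) (z (f (m + 1)) i) :=
        le_min (Finset.inf'_le (fun j => z j i) (Finset.mem_univ _))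
          (Finset.inf'_le (fun j => z j i) (Finset.mem_univ _))
      linarith
    · rw [hj]
      exact (hfr j ε hε).mono fun n hn => by linarith [(abs_le.1 hn).2]
  · obtain ⟨j, -, hj⟩ := Finset.exists_mem_eq_sup' Finset.univ_nonempty fun j => z j i
    refine limsup_eq_of_eventually_of_frequently (fun ε hε => ?_) fun ε hε => ?_
    · filter_upwards [hev ε hε] with n ⟨m, h1, h2, h3⟩
      have := (hbet m n h1 h2 i).2
      have : max (z (f m) i) (z (f (m + 1)) i) ≤
          Finset.univ.sup' Finset.univ_nonempty (fun j => z j i) :=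
        max_le (Finset.le_sup' (fun j => z j i) (Finset.mem_univ _))
          (Finset.le_sup' (fun j => z j i) (Finset.mem_univ _))
      linarith
    · rw [hj]
      exact (hfr j ε hε).mono fun n hn => by linarith [(abs_le.1 hn).1]

/-- The extreme limit points of the averages along a run that stays in a strongly connected
component form a finite family of limits of cycle means. -/
theorem exists_family_of_word [Finite α] [Fintype ι] [Nonempty ι]
    (A : DetWeightedAutomaton.{u, v, 0} α (ι → ℚ)) {q : A.State} {x : ℕ → α}
    (hx : ∀ᶠ n in atTop, A.run x n ∈ A.scc q) :
    ∃ z : ι × Bool → ι → ℝ, (∀ j, z j ∈ closure (A.cycleMeans q)) ∧ ∀ i,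
      liminf (fun n => A.runAvg x n i) atTop =
        Finset.univ.inf' Finset.univ_nonempty (fun j => z j i) ∧
      limsup (fun n => A.runAvg x n i) atTop =
        Finset.univ.sup' Finset.univ_nonempty (fun j => z j i) := by
  obtain ⟨B, hB0, hB⟩ := A.exists_wt_bound
  have ha := A.abs_runAvg_le hB0 hB x
  have hS := fun ε hε => A.eventually_runAvg_near_cycleMeans q hx (ε := ε) hε
  choose z hz hzl hzb using fun i => exists_mem_closure_of_frequently ha hS (j := i)
    fun ε hε => frequently_abs_sub_liminf_le (fun n => ha n i) hε
  choose y hy hyl hyb using fun i => exists_mem_closure_of_frequently ha hS (j := i)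
    fun ε hε => frequently_abs_sub_limsup_le (fun n => ha n i) hε
  -- `(i, false)` attains the lower limit of coordinate `i` and `(i, true)` the upper one; no member
  -- exceeds these limits in any coordinate, so the extrema of the family are exact.
  let t : ι × Bool → ι → ℝ := fun j => bif j.2 then y j.1 else z j.1
  have ht : ∀ j i, liminf (fun n => A.runAvg x n i) atTop ≤ t j i ∧
      t j i ≤ limsup (fun n => A.runAvg x n i) atTop := by
    rintro ⟨j, _ | _⟩ i
    · exact hzb j i
    · exact hyb j i
  refine ⟨t, ?_, fun i => ⟨le_antisymm ?_ ?_, le_antisymm ?_ ?_⟩⟩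
  · rintro ⟨j, _ | _⟩
    · exact hz j
    · exact hy j
  · exact Finset.le_inf' _ _ fun j _ => (ht j i).1
  · exact (Finset.inf'_le (fun j => t j i) (Finset.mem_univ (i, false))).trans (hzl i).le
  · exact (hyl i).ge.trans (Finset.le_sup' (fun j => t j i) (Finset.mem_univ (i, true)))
  · exact Finset.sup'_le _ _ fun j _ => (ht j i).2

end Realization

end DetWeightedAutomaton

/-! ### Büchi acceptance and the final scc of a run -/

namespace DetWeightedAutomaton

section Buchi

variable {α : Type u} {W : Type w}

theorem mem_buchiLanguage_withAccepting (A : DetWeightedAutomaton.{u, v, w} α W)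
    (F : Set A.State) (x : ℕ → α) :
    x ∈ (A.withAccepting F).buchiLanguage ↔ ∃ᶠ n in atTop, A.run x n ∈ F := by
  constructor
  · rintro ⟨r, hr0, hr, hF⟩
    have : r = A.run x := by
      funext n
      induction n with
      | zero => exact hr0
      | succ n ih =>
        have h : r (n + 1) = A.step (r n) (x n) := hr n
        rw [h, ih]
        rfl
    rwa [this] at hF
  · exact fun h => ⟨A.run x, rfl, fun n => rfl, h⟩

theorem transGen_run (A : DetWeightedAutomaton.{u, v, w} α W) (x : ℕ → α) {m n : ℕ}
    (h : m < n) : Relation.TransGen A.Edge (A.run x m) (A.run x n) := by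
  induction h with
  | refl => exact .single ⟨x m, rfl⟩
  | step _ ih => exact ih.tail ⟨x _, rfl⟩

theorem reflTransGen_run (A : DetWeightedAutomaton.{u, v, w} α W) (x : ℕ → α) {m n : ℕ}
    (h : m ≤ n) : Relation.ReflTransGen A.Edge (A.run x m) (A.run x n) := by
  rcases h.eq_or_lt with rfl | h
  · exact .refl
  · exact (A.transGen_run x h).to_reflTransGen

theorem scc_eq_of_mem (A : DetWeightedAutomaton.{u, v, w} α W) {p q : A.State}
    (h : p ∈ A.scc q) : A.scc p = A.scc q :=
  Set.ext fun _ => ⟨fun hr => ⟨h.1.trans hr.1, hr.2.trans h.2⟩,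
    fun hr => ⟨h.2.trans hr.1, hr.2.trans h.1⟩⟩

/-- Every run ends up in a reachable strongly connected component that contains a cycle. -/
theorem exists_eventually_run_mem_scc (A : DetWeightedAutomaton.{u, v, w} α W) (x : ℕ → α) :
    ∃ q, Relation.ReflTransGen A.Edge A.init q ∧ Relation.TransGen A.Edge q q ∧
      ∀ᶠ n in atTop, A.run x n ∈ A.scc q := by
  obtain ⟨q, hq⟩ : ∃ q, ∃ᶠ n in atTop, A.run x n = q := by
    by_contra! hcon
    obtain ⟨n, hn⟩ := (eventually_all.2 hcon).exists
    exact hn _ rfl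
  obtain ⟨n, hn⟩ := hq.exists
  obtain ⟨m, hnm, hm⟩ := frequently_atTop.1 hq (n + 1)
  refine ⟨q, hn ▸ A.reflTransGen_run x n.zero_le, ?_, ?_⟩
  · have := A.transGen_run x (Nat.lt_of_succ_le hnm)
    rwa [hn, hm] at this
  · filter_upwards [eventually_ge_atTop n] with k hk
    obtain ⟨m', hkm, hm'⟩ := frequently_atTop.1 hq k
    exact ⟨hn ▸ A.reflTransGen_run x hk, hm' ▸ A.reflTransGen_run x hkm⟩

/-- The states may live in any universe while `IsOmegaRegular` asks for a `Type`, so the automaton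
is transported to `Fin n`. -/
theorem isOmegaRegular_withAccepting (A : DetWeightedAutomaton.{u, v, w} α W)
    (F : Set A.State) : IsOmegaRegular (A.withAccepting F).buchiLanguage := by
  obtain ⟨n, ⟨e⟩⟩ := Finite.exists_equiv_fin A.State
  let A' : DetWeightedAutomaton.{u, 0, w} α W :=
    { State := Fin n
      init := e A.init
      step := fun q a => e (A.step (e.symm q) a)
      wt := fun q a => A.wt (e.symm q) a }
  have hrun : ∀ x k, A'.run x k = e (A.run x k) := fun x k => by
    induction k with
    | zero => rfl
    | succ k ih =>
      change e (A.step (e.symm (A'.run x k)) (x k)) = e (A.step (A.run x k) (x k))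
      rw [ih, e.symm_apply_apply]
  refine ⟨Fin n, inferInstance, A'.withAccepting (e '' F), Set.ext fun x => ?_⟩
  rw [mem_buchiLanguage_withAccepting A', mem_buchiLanguage_withAccepting A]
  simp only [hrun, e.injective.mem_set_image]

end Buchi

end DetWeightedAutomaton

/-! ### Value sets of strongly connected components -/

namespace MeanPayoffExpr

section Values

variable {α : Type u}

instance instNonemptyLeaf : (E : MeanPayoffExpr.{u, v} α) → Nonempty E.Leaf
  | atom _ _ => ⟨()⟩
  | emax E _ => (instNonemptyLeaf E).map Sum.inl
  | emin E _ => (instNonemptyLeaf E).map Sum.inl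
  | esum E _ => (instNonemptyLeaf E).map Sum.inl

/-- The value of an expression in terms of the lower and upper limit averages at its leaves. -/
def evalLimits : (E : MeanPayoffExpr.{u, v} α) → (E.Leaf → ℝ) → (E.Leaf → ℝ) → ℝ
  | atom .limInf _, lo, _ => lo ()
  | atom .limSup _, _, hi => hi ()
  | emax E F, lo, hi => max (evalLimits E (fun i => lo (.inl i)) (fun i => hi (.inl i)))
      (evalLimits F (fun i => lo (.inr i)) (fun i => hi (.inr i)))
  | emin E F, lo, hi => min (evalLimits E (fun i => lo (.inl i)) (fun i => hi (.inl i)))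
      (evalLimits F (fun i => lo (.inr i)) (fun i => hi (.inr i)))
  | esum E F, lo, hi => evalLimits E (fun i => lo (.inl i)) (fun i => hi (.inl i)) +
      evalLimits F (fun i => lo (.inr i)) (fun i => hi (.inr i))

/-- The parameter space `X` stays fixed while the induction restricts the limits to the leaves of
subexpressions. -/
theorem continuous_evalLimits {X : Type*} [TopologicalSpace X] (E : MeanPayoffExpr.{u, v} α)
    {lo hi : X → E.Leaf → ℝ} (hlo : ∀ i, Continuous fun t => lo t i)
    (hhi : ∀ i, Continuous fun t => hi t i) :
    Continuous fun t => E.evalLimits (lo t) (hi t) := by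
  induction E with
  | atom mode A =>
    cases mode
    · exact hlo ()
    · exact hhi ()
  | emax E F ihE ihF =>
    exact (ihE (fun i => hlo (.inl i)) fun i => hhi (.inl i)).max
      (ihF (fun i => hlo (.inr i)) fun i => hhi (.inr i))
  | emin E F ihE ihF =>
    exact (ihE (fun i => hlo (.inl i)) fun i => hhi (.inl i)).min
      (ihF (fun i => hlo (.inr i)) fun i => hhi (.inr i))
  | esum E F ihE ihF =>
    exact (ihE (fun i => hlo (.inl i)) fun i => hhi (.inl i)).add
      (ihF (fun i => hlo (.inr i)) fun i => hhi (.inr i))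

theorem lang_eq_evalLimits_aut (E : MeanPayoffExpr.{u, v} α) (x : ℕ → α) :
    E.lang x = E.evalLimits
      (fun i => liminf (prefixAvg fun n => ((E.aut i).runWeights x n : ℝ)) atTop)
      (fun i => limsup (prefixAvg fun n => ((E.aut i).runWeights x n : ℝ)) atTop) := by
  induction E with
  | atom mode A => cases mode <;> rfl
  | emax E F ihE ihF => rw [lang, ihE, ihF]; rfl
  | emin E F ihE ihF => rw [lang, ihE, ihF]; rfl
  | esum E F ihE ihF => rw [lang, ihE, ihF]; rfl

theorem product_run_apply (E : MeanPayoffExpr.{u, v} α) (x : ℕ → α) (n : ℕ) (i : E.Leaf) :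
    E.product.run x n i = (E.aut i).run x n := by
  induction n with
  | zero => rfl
  | succ n ih =>
    change (E.aut i).step (E.product.run x n i) (x n) = _
    rw [ih]
    rfl

theorem lang_eq_evalLimits (E : MeanPayoffExpr.{u, v} α) (x : ℕ → α) :
    E.lang x = E.evalLimits (fun i => liminf (fun n => E.product.runAvg x n i) atTop)
      (fun i => limsup (fun n => E.product.runAvg x n i) atTop) := by
  have h : ∀ i n, E.product.runWeights x n i = (E.aut i).runWeights x n := fun i n => by
    change (E.aut i).wt (E.product.run x n i) (x n) = _
    rw [product_run_apply]
    rfl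
  simp only [DetWeightedAutomaton.runAvg, h]
  exact E.lang_eq_evalLimits_aut x

/-- The two realization results identify the value set with the continuous image `g '' K` of a
nonempty compact convex set. -/
theorem exists_valuesIn_scc_eq_Icc [Finite α] (E : MeanPayoffExpr.{u, v} α)
    {q : E.product.State} (hq : Relation.ReflTransGen E.product.Edge E.product.init q)
    (hcyc : Relation.TransGen E.product.Edge q q) :
    ∃ m M : ℝ, m ≤ M ∧ E.valuesIn (E.product.scc q) = Set.Icc m M := by
  cases nonempty_fintype E.Leaf
  set P := closure (E.product.cycleMeans q) with hP
  let K : Set (E.Leaf × Bool → E.Leaf → ℝ) := Set.univ.pi fun _ => P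
  let g : (E.Leaf × Bool → E.Leaf → ℝ) → ℝ := fun z => E.evalLimits
    (fun i => Finset.univ.inf' Finset.univ_nonempty fun j => z j i)
    (fun i => Finset.univ.sup' Finset.univ_nonempty fun j => z j i)
  have hg : Continuous g := E.continuous_evalLimits
    (fun i => Continuous.finset_inf'_apply _ fun j _ => by fun_prop)
    (fun i => Continuous.finset_sup'_apply _ fun j _ => by fun_prop)
  have himg : E.valuesIn (E.product.scc q) = g '' K := by
    ext y
    constructor
    · rintro ⟨x, hx, rfl⟩
      obtain ⟨z, hz, hlim⟩ := E.product.exists_family_of_word hx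
      refine ⟨z, fun j _ => hz j, ?_⟩
      rw [lang_eq_evalLimits]
      simp only [g, hlim]
    · rintro ⟨z, hz, rfl⟩
      obtain ⟨x, hx, hlim⟩ := E.product.exists_word_of_family hq fun j => hz j trivial
      refine ⟨x, hx, ?_⟩
      rw [lang_eq_evalLimits]
      simp only [g, hlim]
  obtain ⟨l, hl, hlq⟩ := E.product.exists_cycle_of_transGen hcyc
  obtain ⟨c, hc, -⟩ := E.product.exists_mem_cycleMeans hl hlq
  have hne : K.Nonempty := ⟨fun _ => c, fun _ _ => subset_closure hc⟩
  have hcpt : IsCompact K :=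
    isCompact_univ_pi fun _ => E.product.isCompact_closure_cycleMeans q
  have hconv : Convex ℝ K := convex_pi fun _ _ => E.product.convex_closure_cycleMeans q
  have hconn : IsConnected (g '' K) :=
    ⟨hne.image g, hconv.isPreconnected.image g hg.continuousOn⟩
  have hcpt' := hcpt.image hg
  refine ⟨sInf (g '' K), sSup (g '' K), ?_, himg.trans (eq_Icc_of_connected_compact hconn hcpt')⟩
  exact csInf_le_csSup (hne.image g) hcpt'.bddBelow hcpt'.bddAbove

end Values

end MeanPayoffExpr

/-! ### The isolated cut-point theorem -/

theorem mainTheorem6 {α : Type u} [Finite α] (E : MeanPayoffExpr.{u, v} α) (η : ℝ)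
    (hη : IsIsolatedCutPoint E.lang η) :
    IsOmegaRegular (cutPointLanguage E.lang η) ∧
    (∀ q : E.product.State,
      Relation.ReflTransGen E.product.Edge E.product.init q →
      Relation.TransGen E.product.Edge q q →
      ∃ m M : ℝ, m ≤ M ∧ E.valuesIn (E.product.scc q) = Set.Icc m M ∧ η ∉ Set.Icc m M) ∧
    (E.product.withAccepting
        {q | ∃ m : ℝ, IsLeast (E.valuesIn (E.product.scc q)) m ∧ η < m}).buchiLanguage =
      cutPointLanguage E.lang η := by
  have hvalues : ∀ q : E.product.State,
      Relation.ReflTransGen E.product.Edge E.product.init q →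
      Relation.TransGen E.product.Edge q q →
      ∃ m M : ℝ, m ≤ M ∧ E.valuesIn (E.product.scc q) = Set.Icc m M ∧ η ∉ Set.Icc m M := by
    intro q hq hcyc
    obtain ⟨m, M, hmM, h⟩ := E.exists_valuesIn_scc_eq_Icc hq hcyc
    refine ⟨m, M, hmM, h, fun hmem => ?_⟩
    rw [← h] at hmem
    -- Points of the interval are attained values, so `η` would be the value of a word.
    obtain ⟨x, -, hx⟩ := hmem
    obtain ⟨ε, hε, hdist⟩ := hη
    have := hdist x
    rw [hx, sub_self, abs_zero] at this
    exact this.not_gt hε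
  have hlang : (E.product.withAccepting
      {q | ∃ m : ℝ, IsLeast (E.valuesIn (E.product.scc q)) m ∧ η < m}).buchiLanguage =
      cutPointLanguage E.lang η := by
    ext x
    rw [DetWeightedAutomaton.mem_buchiLanguage_withAccepting]
    obtain ⟨q, hq, hcyc, hx⟩ := E.product.exists_eventually_run_mem_scc x
    have hmem : E.lang x ∈ E.valuesIn (E.product.scc q) := ⟨x, hx, rfl⟩
    constructor
    · intro hF
      obtain ⟨n, ⟨m, hm, hηm⟩, hn⟩ := (hF.and_eventually hx).exists
      rw [E.product.scc_eq_of_mem hn] at hm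
      exact hηm.le.trans (hm.2 hmem)
    · intro hge
      obtain ⟨m, M, hmM, h, hout⟩ := hvalues q hq hcyc
      rw [h] at hmem
      -- The interval contains a value that is at least `η` but not `η` itself, so it lies entirely
      -- above `η`.
      have hηm : η < m := by
        by_contra hcon
        exact hout ⟨not_lt.1 hcon, le_trans hge hmem.2⟩
      refine (hx.mono fun n hn => ⟨m, ?_, hηm⟩).frequently
      rw [E.product.scc_eq_of_mem hn, h]
      exact isLeast_Icc hmM
  refine ⟨?_, hvalues, hlang⟩
  rw [← hlang]
  exact E.product.isOmegaRegular_withAccepting _
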